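/- Let $d$ be a dimension. There exists a positive function $\psi(t)$ on $t\ge 0$ such that for every real $\alpha$ there is a constant $c(\alpha)$ with $\psi(t)\le c(\alpha)(1+t)^{-\alpha}$ for all $t\ge 0$, and such that the following holds. For every Lebesgue measurable set $\Omega\subseteq\mathbb{R}^d$ and every $R>0$ there exist entire functions $A,B:\mathbb{C}^d\to\mathbb{C}$ of exponential type $R$, real valued on $\mathbb{R}^d$, such that for every $x\in\mathbb{R}^d$ $$A(x)\le\chi_\Omega(x)\le B(x),\qquad |B(x)-A(x)|\le\psi\bigl(R\operatorname{dist}(x,\partial\Omega)\bigr).$$ Here $\chi_\Omega$ is the characteristic function of $\Omega$ and $\partial\Omega$ its topological boundary; if $\partial\Omega=\emptyset$ then $\operatorname{dist}(x,\partial\Omega)=+\infty$ and $\psi(+\infty)=0$. An entire function $F$ on $\mathbb{C}^d$ is of exponential type $R$ if for every $\varepsilon>0$ there is a constant $C$ with $|F(z)|\le C e^{(R+\varepsilon)|z|}$ for all $z\in\mathbb{C}^d$, where $|z|$ is the Euclidean norm. The function $\psi$ depends on $d$, but not on $\Omega$ or $R$. -/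

import Mathlib

/-- The inclusion of `ℝ^d` into `ℂ^d`. -/
noncomputable def realPoint {d : ℕ} (x : EuclideanSpace ℝ (Fin d)) : EuclideanSpace ℂ (Fin d) :=
  WithLp.toLp 2 (fun i => ((x i : ℝ) : ℂ))

/-- `F : ℂ^d → ℂ` is an entire function of exponential type (at most) `R`: it is holomorphic on
`ℂ^d`, and for every `ε > 0` there is a constant `C` with `|F(z)| ≤ C exp((R + ε)|z|)`, where `|z|`
is the Euclidean (Hermitian) norm. -/
def IsEntireOfExpType {d : ℕ} (R : ℝ) (F : EuclideanSpace ℂ (Fin d) → ℂ) : Prop :=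
  Differentiable ℂ F ∧
    ∀ ε : ℝ, 0 < ε → ∃ C : ℝ, ∀ z : EuclideanSpace ℂ (Fin d),
      ‖F z‖ ≤ C * Real.exp ((R + ε) * ‖z‖)

/-! Smoothing `χ_Ω` by a nonnegative, rapidly decreasing kernel `κ` that extends to an entire
function of exponential type 1 gives an entire function `m`. At `x`, it differs from `I χ_Ω(x)`,
where `I = ∫ κ`, by at most the mass `T(δ(x))` of `κ` outside the ball of radius `δ(x) = dist(x,
∂Ω)`, because `χ_Ω` is constant on the ball of that radius about `x`
(`abs_integral_mul_sub_le_tailMass`).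

One-sidedness needs an entire majorant of this error of comparable size. Convolving `T(δ - 1)` with
the same `κ` provides it: as `δ` is 1-Lipschitz, the result `G` satisfies `q T(δ) ≤ G ≤ I (T(δ/2 -
1) + T(δ/2))`, where `q` is the mass of `κ` on the unit ball (`le_integral_tailMass_mul`,
`integral_tailMass_mul_le`). Then `(m ∓ G/q)/I` are the minorant and the majorant, and a dilation
reduces general `R` to `R = 1`.

The kernel is a product of one-variable factors `|ĝ|²` with `g` a smooth bump: compact support gives
the exponential type, smoothness the decay. -/

open MeasureTheory

/-! ### The one-dimensional kernel -/

/-- The Fourier–Laplace transform `z ↦ ∫ g(ξ) exp(i z ξ) dξ` of a function on the line. -/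
noncomputable def fourierLaplace (g : ℝ → ℝ) (z : ℂ) : ℂ :=
  ∫ ξ : ℝ, (g ξ : ℂ) * Complex.exp (Complex.I * z * ξ)

theorem hasCompactSupport_of_tsupport_subset_Icc {g : ℝ → ℝ} (hs : tsupport g ⊆ Set.Icc (-1) 1) :
    HasCompactSupport g :=
  isCompact_Icc.of_isClosed_subset (isClosed_tsupport g) hs

theorem norm_mul_exp_le {g : ℝ → ℝ} (hs : tsupport g ⊆ Set.Icc (-1) 1) (z : ℂ) (ξ : ℝ) :
    ‖(g ξ : ℂ) * Complex.exp (Complex.I * z * ξ)‖ ≤ |g ξ| * Real.exp |z.im| := by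
  by_cases hξ : ξ ∈ tsupport g
  · rw [norm_mul, Complex.norm_real, Real.norm_eq_abs, Complex.norm_exp]
    gcongr
    have h1 : (Complex.I * z * ξ).re = -z.im * ξ := by simp
    rw [h1]
    have h2 : |ξ| ≤ 1 := abs_le.2 (hs hξ)
    calc -z.im * ξ ≤ |-z.im * ξ| := le_abs_self _
      _ = |z.im| * |ξ| := by rw [abs_mul, abs_neg]
      _ ≤ |z.im| := mul_le_of_le_one_right (abs_nonneg _) h2
  · simp [image_eq_zero_of_notMem_tsupport hξ]

theorem integrable_mul_exp {g : ℝ → ℝ} (hg : Continuous g) (hs : tsupport g ⊆ Set.Icc (-1) 1)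
    (z : ℂ) : Integrable fun ξ : ℝ => (g ξ : ℂ) * Complex.exp (Complex.I * z * ξ) := by
  refine Continuous.integrable_of_hasCompactSupport (by fun_prop) ?_
  exact ((hasCompactSupport_of_tsupport_subset_Icc hs).comp_left (g := fun r : ℝ => (r : ℂ))
    Complex.ofReal_zero).mul_right

theorem norm_fourierLaplace_le {g : ℝ → ℝ} (hg : Continuous g)
    (hs : tsupport g ⊆ Set.Icc (-1) 1) (z : ℂ) :
    ‖fourierLaplace g z‖ ≤ (∫ ξ, |g ξ|) * Real.exp |z.im| := by
  rw [← integral_mul_const]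
  refine norm_integral_le_of_norm_le ?_ (Filter.Eventually.of_forall (norm_mul_exp_le hs z))
  exact ((hg.integrable_of_hasCompactSupport
    (hasCompactSupport_of_tsupport_subset_Icc hs)).abs).mul_const _

theorem tsupport_deriv_subset_Icc {g : ℝ → ℝ} (hs : tsupport g ⊆ Set.Icc (-1) 1) :
    tsupport (deriv g) ⊆ Set.Icc (-1) 1 :=
  (closure_minimal support_deriv_subset (isClosed_tsupport g)).trans hs

/-- Integration by parts. Iterated, it trades powers of `z` for derivatives of `g`, whose supports
stay in `[-1, 1]`. -/
theorem mul_fourierLaplace {g : ℝ → ℝ} (hg : ContDiff ℝ (⊤ : ℕ∞) g)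
    (hs : tsupport g ⊆ Set.Icc (-1) 1) (z : ℂ) :
    z * fourierLaplace g z = Complex.I * fourierLaplace (deriv g) z := by
  have hcd : Continuous (deriv g) := hg.continuous_deriv (by exact_mod_cast le_top)
  have hd : Differentiable ℝ g := hg.differentiable (by simp)
  have key := integral_mul_deriv_eq_deriv_mul_of_integrable
    (u := fun ξ : ℝ => (g ξ : ℂ)) (u' := fun ξ : ℝ => ((deriv g ξ : ℝ) : ℂ))
    (v := fun ξ : ℝ => Complex.exp (Complex.I * z * ξ))
    (v' := fun ξ : ℝ => Complex.exp (Complex.I * z * ξ) * (Complex.I * z))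
    (fun x _ => (hd x).hasDerivAt.ofReal_comp)
    (fun x _ => by
      have h := ((Complex.ofRealCLM.hasDerivAt (x := x)).const_mul (Complex.I * z)).cexp
      simpa using h)
    (by
      have h := (integrable_mul_exp hg.continuous hs z).mul_const (Complex.I * z)
      refine h.congr (Filter.Eventually.of_forall fun ξ => ?_)
      simp [mul_assoc])
    (integrable_mul_exp hcd (tsupport_deriv_subset_Icc hs) z)
    (integrable_mul_exp hg.continuous hs z)
  have h2 : ∫ x : ℝ, (g x : ℂ) * (Complex.exp (Complex.I * z * x) * (Complex.I * z))
      = fourierLaplace g z * (Complex.I * z) := by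
    rw [fourierLaplace, ← integral_mul_const]
    simp only [mul_assoc]
  rw [h2] at key
  change _ = - fourierLaplace (deriv g) z at key
  linear_combination (-Complex.I) * key + (z * fourierLaplace g z) * Complex.I_sq

theorem exists_norm_pow_mul_fourierLaplace_le (n : ℕ) {g : ℝ → ℝ} (hg : ContDiff ℝ (⊤ : ℕ∞) g)
    (hs : tsupport g ⊆ Set.Icc (-1) 1) :
    ∃ C : ℝ, 0 ≤ C ∧ ∀ z : ℂ, ‖z‖ ^ n * ‖fourierLaplace g z‖ ≤ C * Real.exp |z.im| := by
  induction n generalizing g with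
  | zero =>
    refine ⟨∫ ξ, |g ξ|, integral_nonneg fun _ => abs_nonneg _, fun z => ?_⟩
    simpa using norm_fourierLaplace_le hg.continuous hs z
  | succ n ih =>
    obtain ⟨C, hC0, hC⟩ := ih (g := deriv g)
      ((contDiff_infty_iff_deriv.1 hg).2) (tsupport_deriv_subset_Icc hs)
    refine ⟨C, hC0, fun z => ?_⟩
    have h := congrArg norm (mul_fourierLaplace hg hs z)
    rw [norm_mul, norm_mul, Complex.norm_I, one_mul] at h
    rw [pow_succ, mul_assoc, h]
    exact hC z

theorem differentiable_fourierLaplace {g : ℝ → ℝ} (hg : Continuous g)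
    (hs : tsupport g ⊆ Set.Icc (-1) 1) : Differentiable ℂ (fourierLaplace g) := by
  intro z₀
  have hsup := hasCompactSupport_of_tsupport_subset_Icc hs
  refine (hasDerivAt_integral_of_dominated_loc_of_deriv_le
    (F := fun z (ξ : ℝ) => (g ξ : ℂ) * Complex.exp (Complex.I * z * ξ))
    (F' := fun z (ξ : ℝ) => (g ξ : ℂ) * (Complex.exp (Complex.I * z * ξ) * (Complex.I * ξ)))
    (bound := fun ξ => |g ξ| * Real.exp (|z₀.im| + 1)) (μ := volume)
    (Metric.ball_mem_nhds z₀ one_pos) ?_ ?_ ?_ ?_ ?_ ?_).2.differentiableAt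
  · exact Filter.Eventually.of_forall fun z => (integrable_mul_exp hg hs z).aestronglyMeasurable
  · exact integrable_mul_exp hg hs z₀
  · exact Continuous.aestronglyMeasurable (by fun_prop)
  · refine Filter.Eventually.of_forall fun ξ z hz => ?_
    have h1 := norm_mul_exp_le hs z ξ
    have h3 : |z.im| ≤ |z₀.im| + 1 := by
      have h4 : |(z - z₀).im| ≤ 1 :=
        (Complex.abs_im_le_norm _).trans (mem_ball_iff_norm.1 hz).le
      rw [Complex.sub_im] at h4
      linarith [abs_sub_abs_le_abs_sub z.im z₀.im]
    by_cases hξ : ξ ∈ tsupport g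
    · have h2 : ‖Complex.I * (ξ : ℂ)‖ ≤ 1 := by
        simpa using abs_le.2 (hs hξ)
      rw [← mul_assoc, norm_mul]
      calc _ ≤ (|g ξ| * Real.exp |z.im|) * 1 := by gcongr
        _ ≤ _ := by rw [mul_one]; gcongr
    · simp [image_eq_zero_of_notMem_tsupport hξ]
  · exact ((hg.integrable_of_hasCompactSupport hsup).abs).mul_const _
  · refine Filter.Eventually.of_forall fun ξ z _ => HasDerivAt.const_mul _ ?_
    have h : HasDerivAt (fun z : ℂ => Complex.I * z * ξ) (Complex.I * ξ) z := by
      simpa using ((hasDerivAt_id z).const_mul Complex.I).mul_const (ξ : ℂ)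
    exact h.cexp

theorem fourierLaplace_neg_ofReal (g : ℝ → ℝ) (x : ℝ) :
    fourierLaplace g (-(x : ℂ)) = (starRingEnd ℂ) (fourierLaplace g x) := by
  rw [fourierLaplace, fourierLaplace, ← integral_conj]
  congr 1
  ext ξ
  rw [map_mul, Complex.conj_ofReal, ← Complex.exp_conj]
  simp

/-- A one-dimensional kernel of exponential type. -/
theorem exists_line_kernel :
    ∃ k : ℂ → ℂ, Differentiable ℂ k ∧
      (∀ x : ℝ, ∃ r : ℝ, 0 ≤ r ∧ k x = r) ∧ (∃ r : ℝ, 0 < r ∧ k 0 = r) ∧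
      ∀ n : ℕ, ∃ C : ℝ, 0 ≤ C ∧ ∀ z : ℂ,
        (1 + ‖z‖) ^ n * ‖k z‖ ≤ C * Real.exp (2 * |z.im|) := by
  let f : ContDiffBump (0 : ℝ) := ⟨1 / 2, 1, by norm_num, by norm_num⟩
  have hg : ContDiff ℝ (⊤ : ℕ∞) f := f.contDiff
  have hs : tsupport f ⊆ Set.Icc (-1) 1 := by
    rw [f.tsupport_eq, Real.closedBall_eq_Icc]; simp [f]
  have hreal : ∀ x : ℝ, fourierLaplace f x * fourierLaplace f (-(x : ℂ))
      = ((‖fourierLaplace f x‖ ^ 2 : ℝ) : ℂ) := fun x => by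
    rw [fourierLaplace_neg_ofReal, Complex.mul_conj, Complex.normSq_eq_norm_sq]
  -- On the real line the second factor is the conjugate of the first, so the product is `|f̂|² ≥
  -- 0`; two factors of type 1 give type 2.
  refine ⟨fun z => fourierLaplace f z * fourierLaplace f (-z), ?_, ?_, ?_, ?_⟩
  · have h := differentiable_fourierLaplace hg.continuous hs
    exact h.mul (h.comp differentiable_neg)
  · exact fun x => ⟨_, by positivity, hreal x⟩
  · have h0 : fourierLaplace f 0 = ((∫ ξ, f ξ : ℝ) : ℂ) := by
      simp only [fourierLaplace, mul_zero, zero_mul, Complex.exp_zero, mul_one]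
      exact integral_ofReal
    have h1 : 0 < ∫ ξ, f ξ := f.integral_pos
    refine ⟨(∫ ξ, f ξ) ^ 2, by positivity, ?_⟩
    simp only [neg_zero, h0]
    push_cast; ring
  · intro n
    obtain ⟨C₀, hC₀, h₀⟩ := exists_norm_pow_mul_fourierLaplace_le 0 hg hs
    obtain ⟨C, hC, h⟩ := exists_norm_pow_mul_fourierLaplace_le n hg hs
    -- The first factor absorbs the whole weight `(1 + ‖z‖)ⁿ ≤ 2ⁿ (1 + ‖z‖ⁿ)`; the second is only
    -- bounded by its exponential.
    refine ⟨2 ^ n * (C₀ + C) * C₀, by positivity, fun z => ?_⟩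
    have h1 : (1 + ‖z‖) ^ n ≤ 2 ^ n * (1 + ‖z‖ ^ n) := by
      have h3 := add_pow_le zero_le_one (norm_nonneg z) n
      rw [one_pow] at h3
      refine h3.trans ?_
      gcongr
      · norm_num
      · exact Nat.sub_le _ _
    have h2 := h₀ z
    have h4 := h₀ (-z)
    have h5 := h z
    rw [pow_zero, one_mul] at h2 h4
    rw [Complex.neg_im, abs_neg] at h4
    rw [norm_mul, two_mul, Real.exp_add]
    calc (1 + ‖z‖) ^ n * (‖fourierLaplace f z‖ * ‖fourierLaplace f (-z)‖)
        ≤ (2 ^ n * (1 + ‖z‖ ^ n)) * (‖fourierLaplace f z‖ * ‖fourierLaplace f (-z)‖) := by gcongr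
      _ = 2 ^ n * (‖fourierLaplace f z‖ + ‖z‖ ^ n * ‖fourierLaplace f z‖)
          * ‖fourierLaplace f (-z)‖ := by ring
      _ ≤ 2 ^ n * (C₀ * Real.exp |z.im| + C * Real.exp |z.im|) * (C₀ * Real.exp |z.im|) := by
          gcongr
      _ = _ := by ring

/-! ### The product kernel on `ℂ^d` -/

theorem realPoint_sub {d : ℕ} (x y : EuclideanSpace ℝ (Fin d)) :
    realPoint (x - y) = realPoint x - realPoint y := by
  ext i; simp [realPoint]

theorem realPoint_smul {d : ℕ} (r : ℝ) (x : EuclideanSpace ℝ (Fin d)) :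
    realPoint (r • x) = (r : ℂ) • realPoint x := by
  ext i; simp [realPoint]

theorem norm_realPoint {d : ℕ} (x : EuclideanSpace ℝ (Fin d)) : ‖realPoint x‖ = ‖x‖ := by
  simp [EuclideanSpace.norm_eq, realPoint]

theorem continuous_realPoint {d : ℕ} : Continuous (realPoint (d := d)) :=
  (isometry_iff_dist_eq.2 fun x y => by
    rw [dist_eq_norm, dist_eq_norm, ← realPoint_sub, norm_realPoint]).continuous

/-- The sum of the absolute values of the imaginary parts of the coordinates. -/
def imSum {d : ℕ} (z : EuclideanSpace ℂ (Fin d)) : ℝ := ∑ i, |(z i).im|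

theorem imSum_sub_realPoint {d : ℕ} (z : EuclideanSpace ℂ (Fin d))
    (y : EuclideanSpace ℝ (Fin d)) : imSum (z - realPoint y) = imSum z := by
  simp [imSum, realPoint]

theorem imSum_le {d : ℕ} (z : EuclideanSpace ℂ (Fin d)) : imSum z ≤ d * ‖z‖ := by
  calc imSum z ≤ ∑ _i : Fin d, ‖z‖ :=
        Finset.sum_le_sum fun i _ => (Complex.abs_im_le_norm _).trans (PiLp.norm_apply_le z i)
    _ = d * ‖z‖ := by simp

theorem imSum_realPoint {d : ℕ} (y : EuclideanSpace ℝ (Fin d)) : imSum (realPoint y) = 0 := by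
  simp [imSum, realPoint]

theorem norm_le_sum_norm {d : ℕ} (z : EuclideanSpace ℂ (Fin d)) : ‖z‖ ≤ ∑ i, ‖z i‖ := by
  rw [EuclideanSpace.norm_eq]
  refine Real.sqrt_le_iff.2 ⟨Finset.sum_nonneg fun _ _ => norm_nonneg _, ?_⟩
  exact Finset.sum_sq_le_sq_sum_of_nonneg fun _ _ => norm_nonneg _

theorem one_add_norm_le_prod {d : ℕ} (z : EuclideanSpace ℂ (Fin d)) :
    1 + ‖z‖ ≤ ∏ i, (1 + ‖z i‖) := by
  refine (add_le_add_right (norm_le_sum_norm z) 1).trans ?_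
  induction (Finset.univ : Finset (Fin d)) using Finset.cons_induction with
  | empty => simp
  | cons i s hi ih =>
    rw [Finset.sum_cons, Finset.prod_cons]
    have h : 0 ≤ ‖z i‖ * ∑ j ∈ s, ‖z j‖ :=
      mul_nonneg (norm_nonneg _) (Finset.sum_nonneg fun _ _ => norm_nonneg _)
    calc 1 + (‖z i‖ + ∑ j ∈ s, ‖z j‖) ≤ (1 + ‖z i‖) * (1 + ∑ j ∈ s, ‖z j‖) := by linarith
      _ ≤ _ := by gcongr

/-- An entire kernel on `ℂ^d` whose restriction to `ℝ^d` is nonnegative and decays faster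
than any power, and which has exponential type in imaginary directions. -/
structure IsEntireKernel {d : ℕ} (K : EuclideanSpace ℂ (Fin d) → ℂ)
    (κ : EuclideanSpace ℝ (Fin d) → ℝ) : Prop where
  contDiff : ContDiff ℂ 1 K
  apply_realPoint : ∀ x, K (realPoint x) = κ x
  nonneg : ∀ x, 0 ≤ κ x
  pos : 0 < κ 0
  decay : ∀ n : ℕ, ∃ C : ℝ, 0 ≤ C ∧ ∀ z,
    (1 + ‖z‖) ^ n * ‖K z‖ ≤ C * Real.exp (imSum z / d)

theorem exists_isEntireKernel (d : ℕ) (hd : d ≠ 0) :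
    ∃ (K : EuclideanSpace ℂ (Fin d) → ℂ) (κ : EuclideanSpace ℝ (Fin d) → ℝ),
      IsEntireKernel K κ := by
  obtain ⟨k, hk, hreal, ⟨r, hr, hkr⟩, hdec⟩ := exists_line_kernel
  choose q hq0 hq using hreal
  have hd0 : (0 : ℝ) < d := by positivity
  have hd1 : (1 : ℝ) ≤ d := by exact_mod_cast Nat.one_le_iff_ne_zero.2 hd
  -- This scaling turns the factor bound `exp (2 |Im (a zᵢ)|)` into `exp (|Im zᵢ| / d)`; the product
  -- is then at most `exp ‖z‖` by `imSum_le`, which is type 1.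
  let a : ℝ := 1 / (2 * d)
  have ha : 0 < a := by positivity
  have ha1 : a ≤ 1 := by
    rw [div_le_one (by positivity)]; linarith
  refine ⟨fun z => ∏ i, k (a * z i), fun x => ∏ i, q (a * x i), ?_, ?_, ?_, ?_, ?_⟩
  · have hk1 : ContDiff ℂ 1 k := hk.contDiff
    refine contDiff_prod fun i _ => hk1.comp (contDiff_const.mul ?_)
    exact (EuclideanSpace.proj (𝕜 := ℂ) i).contDiff
  · intro x
    push_cast
    refine Finset.prod_congr rfl fun i _ => ?_
    rw [← hq]
    simp [realPoint]
  · exact fun x => Finset.prod_nonneg fun i _ => hq0 _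
  · refine Finset.prod_pos fun i _ => ?_
    have h : ((q 0 : ℝ) : ℂ) = r := by rw [← hq, ← hkr]; simp
    have h' : q 0 = r := by exact_mod_cast h
    simpa [h'] using hr
  · intro n
    obtain ⟨C, hC0, hC⟩ := hdec n
    refine ⟨((1 / a) ^ n * C) ^ d, by positivity, fun z => ?_⟩
    have h1 : ∀ i, (1 + ‖z i‖) ^ n * ‖k (a * z i)‖
        ≤ (1 / a) ^ n * C * Real.exp (2 * a * |(z i).im|) := fun i => by
      have h2 := hC (a * z i)
      rw [norm_mul, Complex.norm_real, Real.norm_eq_abs, abs_of_pos ha, Complex.im_ofReal_mul,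
        abs_mul, abs_of_pos ha, ← mul_assoc] at h2
      have h3 : 1 + ‖z i‖ ≤ 1 / a * (1 + a * ‖z i‖) := by
        rw [mul_add, ← mul_assoc, one_div_mul_cancel ha.ne', mul_one, one_mul]
        gcongr
        exact (one_le_div ha).2 ha1
      calc _ ≤ (1 / a * (1 + a * ‖z i‖)) ^ n * ‖k (a * z i)‖ := by gcongr
        _ = (1 / a) ^ n * ((1 + a * ‖z i‖) ^ n * ‖k (a * z i)‖) := by rw [mul_pow, mul_assoc]
        _ ≤ (1 / a) ^ n * (C * Real.exp (2 * a * |(z i).im|)) := by gcongr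
        _ = _ := by rw [mul_assoc ((1 / a) ^ n)]
    calc (1 + ‖z‖) ^ n * ‖∏ i, k (a * z i)‖
        ≤ (∏ i, (1 + ‖z i‖)) ^ n * ‖∏ i, k (a * z i)‖ := by
          gcongr; exact one_add_norm_le_prod z
      _ = ∏ i, ((1 + ‖z i‖) ^ n * ‖k (a * z i)‖) := by
          rw [norm_prod, ← Finset.prod_pow, ← Finset.prod_mul_distrib]
      _ ≤ ∏ i, ((1 / a) ^ n * C * Real.exp (2 * a * |(z i).im|)) :=
          Finset.prod_le_prod (fun _ _ => by positivity) fun i _ => h1 i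
      _ = _ := by
          rw [Finset.prod_mul_distrib, Finset.prod_const, Finset.card_univ, Fintype.card_fin,
            ← Real.exp_sum, ← Finset.mul_sum]
          congr 2
          rw [imSum]
          simp only [a]
          field_simp

/-! ### Convolutions with the kernel are entire of exponential type 1 -/

theorem integrable_one_add_norm_inv_pow (d : ℕ) :
    Integrable fun y : EuclideanSpace ℝ (Fin d) => ((1 + ‖y‖) ^ (d + 1))⁻¹ := by
  have h := integrable_one_add_norm (E := EuclideanSpace ℝ (Fin d)) (μ := volume) (r := d + 1)
    (by simp)
  refine h.congr (Filter.Eventually.of_forall fun y => ?_)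
  change (1 + ‖y‖) ^ (-((d : ℝ) + 1)) = _
  rw [Real.rpow_neg (by positivity)]
  exact_mod_cast rfl

theorem one_add_pow_le_exp {ε : ℝ} (hε : 0 < ε) (n : ℕ) :
    ∃ C : ℝ, 0 ≤ C ∧ ∀ t : ℝ, 0 ≤ t → (1 + t) ^ n ≤ C * Real.exp (ε * t) := by
  refine ⟨n.factorial * Real.exp ε / ε ^ n, by positivity, fun t ht => ?_⟩
  have h := Real.pow_div_factorial_le_exp (x := ε * (1 + t)) (by positivity) n
  rw [div_le_iff₀ (by positivity), mul_pow, mul_add, mul_one, Real.exp_add] at h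
  rw [div_mul_eq_mul_div, le_div_iff₀ (by positivity)]
  linarith

/-- `L` decays like `‖z‖⁻ⁿ` in real directions and has exponential type in imaginary ones. -/
def HasStripDecay {d : ℕ} {V : Type*} [NormedAddCommGroup V] (n : ℕ)
    (L : EuclideanSpace ℂ (Fin d) → V) : Prop :=
  ∃ C : ℝ, 0 ≤ C ∧ ∀ z, (1 + ‖z‖) ^ n * ‖L z‖ ≤ C * Real.exp (imSum z / d)

/-- Real translations leave imaginary parts alone, and `1 + ‖y‖ ≤ (1 + ‖z‖)(1 + ‖z - y‖)` moves the
decay onto `y`. For `n = d + 1` the majorant is integrable in `y`, locally uniformly in `z`. -/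
theorem HasStripDecay.norm_sub_realPoint_le {d : ℕ} {V : Type*} [NormedAddCommGroup V] {n : ℕ}
    {L : EuclideanSpace ℂ (Fin d) → V} (hL : HasStripDecay n L) :
    ∃ C : ℝ, 0 ≤ C ∧ ∀ z y, ‖L (z - realPoint y)‖
      ≤ C * ((1 + ‖z‖) ^ n * Real.exp ‖z‖) * ((1 + ‖y‖) ^ n)⁻¹ := by
  obtain ⟨C, hC0, hC⟩ := hL
  refine ⟨C, hC0, fun z y => ?_⟩
  rw [← div_eq_mul_inv, le_div_iff₀ (by positivity)]
  have h := hC (z - realPoint y)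
  rw [imSum_sub_realPoint] at h
  have h1 : imSum z / d ≤ ‖z‖ := by
    refine div_le_of_le_mul₀ (by positivity) (norm_nonneg _) ?_
    rw [mul_comm]; exact imSum_le z
  have h2 : 1 + ‖y‖ ≤ (1 + ‖z‖) * (1 + ‖z - realPoint y‖) := by
    have h3 : ‖y‖ ≤ ‖z‖ + ‖z - realPoint y‖ := by
      rw [← norm_realPoint y]
      calc ‖realPoint y‖ = ‖z - (z - realPoint y)‖ := by rw [sub_sub_cancel]
        _ ≤ _ := norm_sub_le _ _
    nlinarith [norm_nonneg z, norm_nonneg (z - realPoint y)]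
  calc ‖L (z - realPoint y)‖ * (1 + ‖y‖) ^ n
      ≤ ‖L (z - realPoint y)‖ * ((1 + ‖z‖) * (1 + ‖z - realPoint y‖)) ^ n := by gcongr
    _ = (1 + ‖z‖) ^ n * ((1 + ‖z - realPoint y‖) ^ n * ‖L (z - realPoint y)‖) := by
        rw [mul_pow]; ring
    _ ≤ (1 + ‖z‖) ^ n * (C * Real.exp (imSum z / d)) := by gcongr
    _ ≤ (1 + ‖z‖) ^ n * (C * Real.exp ‖z‖) := by gcongr
    _ = _ := by ring

theorem imSum_add_le {d : ℕ} (z w : EuclideanSpace ℂ (Fin d)) :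
    imSum (z + w) ≤ imSum z + d * ‖w‖ := by
  refine le_trans ?_ (add_le_add_right (imSum_le w) _)
  rw [imSum, imSum, imSum, ← Finset.sum_add_distrib]
  exact Finset.sum_le_sum fun i _ => by simpa using abs_add_le (z i).im (w i).im

/-- Cauchy's estimate on the unit disc in each complex direction: a unit displacement costs at most
`2ⁿ` in the weight and `e` in the exponential. This dominates the derivative under the convolution
integral. -/
theorem HasStripDecay.hasStripDecay_fderiv {d : ℕ} {n : ℕ} {L : EuclideanSpace ℂ (Fin d) → ℂ}
    (hL : HasStripDecay n L) (hd : Differentiable ℂ L) : HasStripDecay n (fderiv ℂ L) := by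
  obtain ⟨C, hC0, hC⟩ := hL
  refine ⟨2 ^ n * C * Real.exp 1, by positivity, fun z => ?_⟩
  rw [mul_comm, ← le_div_iff₀ (by positivity)]
  refine ContinuousLinearMap.opNorm_le_of_unit_norm (𝕜 := ℂ) (by positivity) fun v hv => ?_
  have h1 : HasDerivAt (fun t : ℂ => L (z + t • v)) (fderiv ℂ L z v) 0 := by
    have h2 : HasDerivAt (fun t : ℂ => z + t • v) v 0 := by
      simpa using ((hasDerivAt_id (0 : ℂ)).smul_const v).const_add z
    have h3 : HasFDerivAt L (fderiv ℂ L z) (z + (0 : ℂ) • v) := by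
      simpa using (hd z).hasFDerivAt
    exact h3.comp_hasDerivAt 0 h2
  have h4 : Differentiable ℂ fun t : ℂ => L (z + t • v) :=
    hd.comp ((differentiable_id.smul_const v).const_add z)
  rw [← h1.deriv]
  have key := Complex.norm_deriv_le_of_forall_mem_sphere_norm_le (c := 0) (R := 1)
    (C := 2 ^ n * C * Real.exp 1 * Real.exp (imSum z / d) / (1 + ‖z‖) ^ n) one_pos
    h4.diffContOnCl (fun t ht => ?_)
  · rwa [div_one] at key
  · have ht1 : ‖t • v‖ = 1 := by
      rw [norm_smul, hv, mul_one]; simpa using ht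
    have h5 := hC (z + t • v)
    rw [le_div_iff₀ (by positivity)]
    have h6 : imSum (z + t • v) / d ≤ 1 + imSum z / d := by
      have h7 := imSum_add_le z (t • v)
      rw [ht1, mul_one] at h7
      calc imSum (z + t • v) / d ≤ (imSum z + d) / d := by gcongr
        _ = imSum z / d + d / d := add_div _ _ _
        _ ≤ _ := by rw [add_comm]; gcongr; exact div_self_le_one _
    have h8 : 1 + ‖z‖ ≤ 2 * (1 + ‖z + t • v‖) := by
      have h9 : ‖z‖ ≤ ‖z + t • v‖ + ‖t • v‖ := by
        calc ‖z‖ = ‖z + t • v - t • v‖ := by rw [add_sub_cancel_right]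
          _ ≤ _ := norm_sub_le _ _
      linarith [norm_nonneg (z + t • v)]
    calc ‖L (z + t • v)‖ * (1 + ‖z‖) ^ n
        ≤ ‖L (z + t • v)‖ * (2 * (1 + ‖z + t • v‖)) ^ n := by gcongr
      _ = 2 ^ n * ((1 + ‖z + t • v‖) ^ n * ‖L (z + t • v)‖) := by rw [mul_pow]; ring
      _ ≤ 2 ^ n * (C * Real.exp (imSum (z + t • v) / d)) := by gcongr
      _ ≤ 2 ^ n * (C * Real.exp (1 + imSum z / d)) := by gcongr
      _ = _ := by rw [Real.exp_add]; ring

theorem IsEntireKernel.hasStripDecay {d : ℕ} {K : EuclideanSpace ℂ (Fin d) → ℂ}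
    {κ : EuclideanSpace ℝ (Fin d) → ℝ} (hK : IsEntireKernel K κ) (n : ℕ) : HasStripDecay n K :=
  hK.decay n

/-- Convolution of a function on `ℝ^d` with a kernel on `ℂ^d`. -/
noncomputable def convKernel {d : ℕ} (K : EuclideanSpace ℂ (Fin d) → ℂ)
    (f : EuclideanSpace ℝ (Fin d) → ℝ) (z : EuclideanSpace ℂ (Fin d)) : ℂ :=
  ∫ y, (f y : ℂ) • K (z - realPoint y)

theorem continuous_sub_realPoint {d : ℕ} (z : EuclideanSpace ℂ (Fin d)) :
    Continuous fun y => z - realPoint y :=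
  continuous_const.sub continuous_realPoint

theorem IsEntireKernel.isEntireOfExpType_convKernel {d : ℕ} {K : EuclideanSpace ℂ (Fin d) → ℂ}
    {κ : EuclideanSpace ℝ (Fin d) → ℝ} (hK : IsEntireKernel K κ)
    {f : EuclideanSpace ℝ (Fin d) → ℝ} (hf : AEStronglyMeasurable f) {M : ℝ}
    (hM : ∀ y, |f y| ≤ M) : IsEntireOfExpType 1 (convKernel K f) := by
  have hM0 : 0 ≤ M := (abs_nonneg _).trans (hM 0)
  have hKd : Differentiable ℂ K := hK.contDiff.differentiable (by norm_num)
  have hfm : AEStronglyMeasurable fun y => (f y : ℂ) :=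
    Complex.continuous_ofReal.comp_aestronglyMeasurable hf
  obtain ⟨C, hC0, hC⟩ := (hK.hasStripDecay (d + 1)).norm_sub_realPoint_le
  obtain ⟨C', hC0', hC'⟩ := ((hK.hasStripDecay (d + 1)).hasStripDecay_fderiv hKd).norm_sub_realPoint_le
  have hint := integrable_one_add_norm_inv_pow d
  have hmeas : ∀ z, AEStronglyMeasurable fun y => (f y : ℂ) • K (z - realPoint y) := fun z =>
    hfm.smul (hKd.continuous.comp (continuous_sub_realPoint z)).aestronglyMeasurable
  have hbd : ∀ z y, ‖(f y : ℂ) • K (z - realPoint y)‖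
      ≤ M * (C * ((1 + ‖z‖) ^ (d + 1) * Real.exp ‖z‖)) * ((1 + ‖y‖) ^ (d + 1))⁻¹ := by
    intro z y
    rw [norm_smul, Complex.norm_real, Real.norm_eq_abs, mul_assoc M]
    exact mul_le_mul (hM y) (hC z y) (norm_nonneg _) hM0
  constructor
  · intro z₀
    refine (hasFDerivAt_integral_of_dominated_of_fderiv_le (μ := volume)
      (F := fun z y => (f y : ℂ) • K (z - realPoint y))
      (F' := fun z y => (f y : ℂ) • fderiv ℂ K (z - realPoint y))
      (bound := fun y => M * (C' * ((1 + (‖z₀‖ + 1)) ^ (d + 1) * Real.exp (‖z₀‖ + 1)))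
        * ((1 + ‖y‖) ^ (d + 1))⁻¹)
      (Metric.ball_mem_nhds z₀ one_pos) (Filter.Eventually.of_forall hmeas) ?_ ?_ ?_
      (hint.const_mul _) ?_).differentiableAt
    · exact (hint.const_mul _).mono' (hmeas z₀) (Filter.Eventually.of_forall (hbd z₀))
    · exact hfm.smul ((hK.contDiff.continuous_fderiv (by norm_num)).comp
        (continuous_sub_realPoint z₀)).aestronglyMeasurable
    · refine Filter.Eventually.of_forall fun y z hz => ?_
      have hz1 : ‖z‖ ≤ ‖z₀‖ + 1 := by
        have h1 := (mem_ball_iff_norm.1 hz).le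
        linarith [norm_sub_norm_le z z₀]
      rw [norm_smul, Complex.norm_real, Real.norm_eq_abs, mul_assoc M]
      refine mul_le_mul (hM y) ((hC' z y).trans ?_) (norm_nonneg _) hM0
      gcongr
    · refine Filter.Eventually.of_forall fun y z _ => HasFDerivAt.fun_const_smul ?_ _
      exact (hKd _).hasFDerivAt.comp z ((hasFDerivAt_id z).sub_const _)
  · intro ε hε
    -- The `ε` allowed in the exponential type absorbs the polynomial factor in `‖z‖`.
    obtain ⟨D, hD0, hD⟩ := one_add_pow_le_exp hε (d + 1)
    refine ⟨M * (C * D) * ∫ y : EuclideanSpace ℝ (Fin d), ((1 + ‖y‖) ^ (d + 1))⁻¹, fun z => ?_⟩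
    have h1 : ‖convKernel K f z‖ ≤ M * (C * ((1 + ‖z‖) ^ (d + 1) * Real.exp ‖z‖)) *
        ∫ y : EuclideanSpace ℝ (Fin d), ((1 + ‖y‖) ^ (d + 1))⁻¹ := by
      rw [← integral_const_mul]
      exact norm_integral_le_of_norm_le (hint.const_mul _) (Filter.Eventually.of_forall (hbd z))
    have hI : 0 ≤ ∫ y : EuclideanSpace ℝ (Fin d), ((1 + ‖y‖) ^ (d + 1))⁻¹ :=
      integral_nonneg fun y => by positivity
    refine h1.trans ?_
    have h2 : (1 + ‖z‖) ^ (d + 1) * Real.exp ‖z‖ ≤ D * Real.exp ((1 + ε) * ‖z‖) := by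
      rw [show (1 + ε) * ‖z‖ = ε * ‖z‖ + ‖z‖ by ring, Real.exp_add, ← mul_assoc]
      gcongr
      exact hD _ (norm_nonneg _)
    calc _ ≤ M * (C * (D * Real.exp ((1 + ε) * ‖z‖))) *
        ∫ y : EuclideanSpace ℝ (Fin d), ((1 + ‖y‖) ^ (d + 1))⁻¹ := by gcongr
      _ = _ := by ring

theorem IsEntireKernel.continuous {d : ℕ} {K : EuclideanSpace ℂ (Fin d) → ℂ}
    {κ : EuclideanSpace ℝ (Fin d) → ℝ} (hK : IsEntireKernel K κ) : Continuous κ := by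
  have h : κ = fun x => (K (realPoint x)).re := by
    ext x; rw [hK.apply_realPoint, Complex.ofReal_re]
  rw [h]
  exact Complex.continuous_re.comp (hK.contDiff.continuous.comp continuous_realPoint)

theorem IsEntireKernel.integrable_moment {d : ℕ} {K : EuclideanSpace ℂ (Fin d) → ℂ}
    {κ : EuclideanSpace ℝ (Fin d) → ℝ} (hK : IsEntireKernel K κ) (n : ℕ) :
    Integrable fun y => (1 + ‖y‖) ^ n * κ y := by
  obtain ⟨C, hC0, hC⟩ := hK.decay (n + (d + 1))
  have hc := hK.continuous
  refine ((integrable_one_add_norm_inv_pow d).const_mul C).mono'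
    (Continuous.aestronglyMeasurable (by fun_prop)) (Filter.Eventually.of_forall fun y => ?_)
  have h := hC (realPoint y)
  rw [imSum_realPoint, zero_div, Real.exp_zero, mul_one, norm_realPoint, hK.apply_realPoint,
    Complex.norm_real, Real.norm_of_nonneg (hK.nonneg y), pow_add] at h
  rw [Real.norm_of_nonneg (mul_nonneg (by positivity) (hK.nonneg y)), ← div_eq_mul_inv,
    le_div_iff₀ (by positivity)]
  linarith

theorem IsEntireKernel.integrable {d : ℕ} {K : EuclideanSpace ℂ (Fin d) → ℂ}
    {κ : EuclideanSpace ℝ (Fin d) → ℝ} (hK : IsEntireKernel K κ) : Integrable κ := by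
  simpa using hK.integrable_moment 0

theorem IsEntireKernel.convKernel_realPoint {d : ℕ} {K : EuclideanSpace ℂ (Fin d) → ℂ}
    {κ : EuclideanSpace ℝ (Fin d) → ℝ} (hK : IsEntireKernel K κ)
    (f : EuclideanSpace ℝ (Fin d) → ℝ) (x : EuclideanSpace ℝ (Fin d)) :
    convKernel K f (realPoint x) = ((∫ y, f y * κ (x - y) : ℝ) : ℂ) := by
  refine Eq.trans ?_ integral_ofReal
  rw [convKernel]
  congr 1
  ext y
  rw [← realPoint_sub, hK.apply_realPoint, smul_eq_mul]
  push_cast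
  rfl

/-! ### Tail mass and its convolution with the kernel -/

/-- The mass of `κ` outside the ball of radius `t`. -/
noncomputable def tailMass {d : ℕ} (κ : EuclideanSpace ℝ (Fin d) → ℝ) (t : ℝ) : ℝ :=
  ∫ y in {y | t ≤ ‖y‖}, κ y

theorem measurableSet_le_norm (d : ℕ) (t : ℝ) :
    MeasurableSet {y : EuclideanSpace ℝ (Fin d) | t ≤ ‖y‖} :=
  measurableSet_le measurable_const measurable_norm

section Tail

variable {d : ℕ} {κ : EuclideanSpace ℝ (Fin d) → ℝ}

theorem tailMass_nonneg (h0 : ∀ x, 0 ≤ κ x) (t : ℝ) : 0 ≤ tailMass κ t :=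
  integral_nonneg fun y => h0 y

theorem tailMass_le_integral (hi : Integrable κ) (h0 : ∀ x, 0 ≤ κ x) (t : ℝ) :
    tailMass κ t ≤ ∫ y, κ y :=
  setIntegral_le_integral hi (Filter.Eventually.of_forall h0)

theorem antitone_tailMass (hi : Integrable κ) (h0 : ∀ x, 0 ≤ κ x) : Antitone (tailMass κ) :=
  fun _ _ hst => setIntegral_mono_set hi.integrableOn (Filter.Eventually.of_forall h0)
    (LE.le.eventuallyLE fun _ hy => le_trans hst hy)

/-- Markov's inequality. The range `t ≥ -1` keeps the base nonnegative and covers the later argument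
`t / 2 - 1`. -/
theorem one_add_pow_mul_tailMass_le (h0 : ∀ x, 0 ≤ κ x) (hi : Integrable κ) (n : ℕ)
    (hm : Integrable fun y => (1 + ‖y‖) ^ n * κ y) {t : ℝ} (ht : -1 ≤ t) :
    (1 + t) ^ n * tailMass κ t ≤ ∫ y, (1 + ‖y‖) ^ n * κ y := by
  rw [tailMass, ← integral_const_mul]
  refine le_trans ?_ (setIntegral_le_integral (s := {y | t ≤ ‖y‖}) hm
    (Filter.Eventually.of_forall fun y => mul_nonneg (by positivity) (h0 y)))
  refine setIntegral_mono_on (hi.integrableOn.const_mul _) hm.integrableOn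
    (measurableSet_le_norm d t) fun y hy => ?_
  have : 0 ≤ 1 + t := by linarith
  exact mul_le_mul_of_nonneg_right (pow_le_pow_left₀ this (add_le_add_right hy 1) n) (h0 y)

theorem integral_indicator_sub_left (t : ℝ) (x : EuclideanSpace ℝ (Fin d)) :
    ∫ y, {y | t ≤ ‖y‖}.indicator κ (x - y) = tailMass κ t := by
  rw [integral_sub_left_eq_self ({y | t ≤ ‖y‖}.indicator κ) volume x,
    integral_indicator (measurableSet_le_norm d t), tailMass]

theorem integrable_indicator_sub_left (hi : Integrable κ) (t : ℝ)
    (x : EuclideanSpace ℝ (Fin d)) :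
    Integrable fun y => {y | t ≤ ‖y‖}.indicator κ (x - y) :=
  (hi.indicator (measurableSet_le_norm d t)).comp_sub_left x

theorem integrable_mul_sub_left (hi : Integrable κ) {f : EuclideanSpace ℝ (Fin d) → ℝ}
    (hf : AEStronglyMeasurable f) {M : ℝ} (hM : ∀ y, |f y| ≤ M) (x : EuclideanSpace ℝ (Fin d)) :
    Integrable fun y => f y * κ (x - y) :=
  (hi.comp_sub_left x).bdd_mul hf (Filter.Eventually.of_forall hM)

/-- Only points `y` at distance at least `r` from `x` contribute to `∫ (f y - f x) κ (x - y)`, and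
there `|f y - f x| ≤ 1`. -/
theorem abs_integral_mul_sub_le_tailMass (hi : Integrable κ) (h0 : ∀ x, 0 ≤ κ x)
    {f : EuclideanSpace ℝ (Fin d) → ℝ} (hf : AEStronglyMeasurable f)
    (hf0 : ∀ y, 0 ≤ f y) (hf1 : ∀ y, f y ≤ 1) {x : EuclideanSpace ℝ (Fin d)} {r : ℝ}
    (hr : ∀ y, dist y x < r → f y = f x) :
    |(∫ y, f y * κ (x - y)) - (∫ y, κ y) * f x| ≤ tailMass κ r := by
  have hb : ∀ y, |f y| ≤ 1 := fun y => abs_le.2 ⟨by linarith [hf0 y], hf1 y⟩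
  have h1 : (∫ y, f y * κ (x - y)) - (∫ y, κ y) * f x = ∫ y, (f y - f x) * κ (x - y) := by
    rw [← integral_sub_left_eq_self κ volume x, ← integral_mul_const, ← integral_sub
      (integrable_mul_sub_left hi hf hb x) ((hi.comp_sub_left x).mul_const _)]
    congr 1; ext y; ring
  rw [h1, ← integral_indicator_sub_left r x, ← Real.norm_eq_abs]
  refine norm_integral_le_of_norm_le (integrable_indicator_sub_left hi r x)
    (Filter.Eventually.of_forall fun y => ?_)
  by_cases hy : r ≤ ‖x - y‖
  · rw [Set.indicator_of_mem (by exact hy), norm_mul, Real.norm_of_nonneg (h0 _)]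
    refine mul_le_of_le_one_left (h0 _) (abs_le.2 ⟨?_, ?_⟩) <;>
      linarith [hf0 x, hf0 y, hf1 x, hf1 y]
  · rw [hr y (by rw [dist_eq_norm, norm_sub_rev]; exact not_le.1 hy), sub_self, zero_mul,
      norm_zero]
    exact Set.indicator_nonneg (fun y _ => h0 y) _

theorem aestronglyMeasurable_tailMass_comp (hi : Integrable κ) (h0 : ∀ x, 0 ≤ κ x)
    {δ : EuclideanSpace ℝ (Fin d) → ℝ} (hδ : LipschitzWith 1 δ) :
    AEStronglyMeasurable fun y => tailMass κ (δ y - 1) :=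
  ((antitone_tailMass hi h0).measurable.comp
    (hδ.continuous.measurable.sub_const 1)).aestronglyMeasurable

theorem abs_tailMass_le (hi : Integrable κ) (h0 : ∀ x, 0 ≤ κ x) (t : ℝ) :
    |tailMass κ t| ≤ ∫ y, κ y := by
  rw [abs_of_nonneg (tailMass_nonneg h0 _)]; exact tailMass_le_integral hi h0 _

/-- This is what the shift by 1 is for: within distance 1 of `x`, `δ y - 1 ≤ δ x`, and the tail mass
is antitone. -/
theorem le_integral_tailMass_mul (hi : Integrable κ) (h0 : ∀ x, 0 ≤ κ x)
    {δ : EuclideanSpace ℝ (Fin d) → ℝ} (hδ : LipschitzWith 1 δ) (x : EuclideanSpace ℝ (Fin d)) :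
    (∫ y in Metric.closedBall 0 1, κ y) * tailMass κ (δ x)
      ≤ ∫ y, tailMass κ (δ y - 1) * κ (x - y) := by
  have hmeas : MeasurableSet (Metric.closedBall (0 : EuclideanSpace ℝ (Fin d)) 1) :=
    measurableSet_closedBall
  rw [← integral_indicator hmeas, ← integral_sub_left_eq_self _ volume x, ← integral_mul_const]
  refine integral_mono (((hi.indicator hmeas).comp_sub_left x).mul_const _)
    (integrable_mul_sub_left hi (aestronglyMeasurable_tailMass_comp hi h0 hδ)
      (fun y => abs_tailMass_le hi h0 _) x) fun y => ?_
  by_cases hy : x - y ∈ Metric.closedBall (0 : EuclideanSpace ℝ (Fin d)) 1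
  · simp only [Set.indicator_of_mem hy]
    rw [mul_comm]
    refine mul_le_mul_of_nonneg_right (antitone_tailMass hi h0 ?_) (h0 _)
    have h1 := hδ.dist_le_mul y x
    rw [mem_closedBall_zero_iff] at hy
    rw [NNReal.coe_one, one_mul, dist_eq_norm y x, norm_sub_rev, Real.dist_eq] at h1
    linarith [le_abs_self (δ y - δ x)]
  · simp only [Set.indicator_of_notMem hy, zero_mul]
    exact mul_nonneg (tailMass_nonneg h0 _) (h0 _)

/-- If `‖x - y‖ < δ x / 2`, then `δ y ≥ δ x / 2`, which gives the first term. Farther away the tail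
mass is bounded by the total mass, and the `κ`-mass of that region is the second term. -/
theorem integral_tailMass_mul_le (hi : Integrable κ) (h0 : ∀ x, 0 ≤ κ x)
    {δ : EuclideanSpace ℝ (Fin d) → ℝ} (hδ : LipschitzWith 1 δ) (x : EuclideanSpace ℝ (Fin d)) :
    ∫ y, tailMass κ (δ y - 1) * κ (x - y)
      ≤ (∫ y, κ y) * (tailMass κ (δ x / 2 - 1) + tailMass κ (δ x / 2)) := by
  have h1 : (∫ y, κ y) * (tailMass κ (δ x / 2 - 1) + tailMass κ (δ x / 2))
      = ∫ y, (tailMass κ (δ x / 2 - 1) * κ (x - y)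
        + (∫ y, κ y) * {y | δ x / 2 ≤ ‖y‖}.indicator κ (x - y)) := by
    rw [integral_add ((hi.comp_sub_left x).const_mul _)
      ((integrable_indicator_sub_left hi _ x).const_mul _), integral_const_mul,
      integral_const_mul, integral_indicator_sub_left, integral_sub_left_eq_self κ volume x]
    ring
  rw [h1]
  refine integral_mono (integrable_mul_sub_left hi (aestronglyMeasurable_tailMass_comp hi h0 hδ)
      (fun y => abs_tailMass_le hi h0 _) x) (((hi.comp_sub_left x).const_mul _).add
      ((integrable_indicator_sub_left hi _ x).const_mul _)) fun y => ?_
  by_cases hy : δ x / 2 ≤ ‖x - y‖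
  · simp only [Set.indicator_of_mem (show x - y ∈ {y | δ x / 2 ≤ ‖y‖} from hy)]
    have h2 := mul_le_mul_of_nonneg_right (tailMass_le_integral hi h0 (δ y - 1)) (h0 (x - y))
    have h3 := mul_nonneg (tailMass_nonneg h0 (δ x / 2 - 1)) (h0 (x - y))
    linarith
  · simp only [Set.indicator_of_notMem (show x - y ∉ {y | δ x / 2 ≤ ‖y‖} from hy), mul_zero,
      add_zero]
    refine mul_le_mul_of_nonneg_right (antitone_tailMass hi h0 ?_) (h0 _)
    have h2 := hδ.dist_le_mul x y
    rw [NNReal.coe_one, one_mul, dist_eq_norm x y, Real.dist_eq] at h2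
    linarith [le_abs_self (δ x - δ y)]

end Tail

/-! ### Rapid decay of the error bound -/

theorem exists_rpow_bound_of_pow_bound {ψ : ℝ → ℝ}
    (h : ∀ n : ℕ, ∃ C : ℝ, 0 ≤ C ∧ ∀ t : ℝ, 0 ≤ t → (1 + t) ^ n * ψ t ≤ C) (α : ℝ) :
    ∃ c : ℝ, ∀ t : ℝ, 0 ≤ t → ψ t ≤ c * (1 + t) ^ (-α) := by
  obtain ⟨n, hn⟩ := exists_nat_ge α
  obtain ⟨C, hC0, hC⟩ := h n
  refine ⟨C, fun t ht => ?_⟩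
  have h1 : ψ t ≤ C / (1 + t) ^ n := by
    rw [le_div_iff₀ (by positivity), mul_comm]; exact hC t ht
  refine h1.trans ?_
  rw [div_eq_mul_inv, Real.rpow_neg (by positivity)]
  have h2 : (1 + t) ^ α ≤ (1 + t) ^ n := by
    rw [← Real.rpow_natCast]
    exact Real.rpow_le_rpow_of_exponent_le (by linarith) hn
  have h3 : 0 < (1 + t) ^ α := Real.rpow_pos_of_pos (by linarith) _
  gcongr

theorem exists_pow_mul_tailMass_half_le {d : ℕ} {κ : EuclideanSpace ℝ (Fin d) → ℝ}
    (h0 : ∀ x, 0 ≤ κ x) (hm : ∀ n : ℕ, Integrable fun y => (1 + ‖y‖) ^ n * κ y) (n : ℕ) :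
    ∃ C : ℝ, 0 ≤ C ∧ ∀ t : ℝ, 0 ≤ t →
      (1 + t) ^ n * (tailMass κ (t / 2 - 1) + tailMass κ (t / 2)) ≤ C := by
  have hi : Integrable κ := by simpa using hm 0
  have hM : ∀ n : ℕ, 0 ≤ ∫ y, (1 + ‖y‖) ^ n * κ y := fun n =>
    integral_nonneg fun y => mul_nonneg (by positivity) (h0 y)
  refine ⟨4 ^ n * ((∫ y, κ y) + ∫ y, (1 + ‖y‖) ^ n * κ y) * 2, ?_, fun t ht => ?_⟩
  · have := hM n
    have : 0 ≤ ∫ y, κ y := integral_nonneg fun y => h0 y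
    positivity
  · have h1 : tailMass κ (t / 2 - 1) + tailMass κ (t / 2) ≤ tailMass κ (t / 2 - 1) * 2 := by
      have := antitone_tailMass hi h0 (show t / 2 - 1 ≤ t / 2 by linarith)
      linarith
    have h2 : (1 + t) ^ n * tailMass κ (t / 2 - 1)
        ≤ 4 ^ n * ((∫ y, κ y) + ∫ y, (1 + ‖y‖) ^ n * κ y) := by
      have hT := tailMass_nonneg h0 (t / 2 - 1)
      have h3 := one_add_pow_mul_tailMass_le h0 hi n (hm n) (show -1 ≤ t / 2 - 1 by linarith)
      have h4 := tailMass_le_integral hi h0 (t / 2 - 1)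
      have h5 : (1 + t) ^ n ≤ 4 ^ n * (1 + (1 + (t / 2 - 1)) ^ n) := by
        rw [mul_add, mul_one, ← mul_pow]
        -- For `t ≤ 3`, `1 + t ≤ 4`; for `t ≥ 3`, `1 + t ≤ 2 t = 4 (1 + (t / 2 - 1))`.
        rcases le_total t 3 with h | h
        · have : (1 + t) ^ n ≤ 4 ^ n := pow_le_pow_left₀ (by linarith) (by linarith) n
          have : 0 ≤ (4 * (1 + (t / 2 - 1))) ^ n := pow_nonneg (by linarith) n
          linarith
        · have : (1 + t) ^ n ≤ (4 * (1 + (t / 2 - 1))) ^ n :=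
            pow_le_pow_left₀ (by linarith) (by linarith) n
          have : (0 : ℝ) ≤ 4 ^ n := by positivity
          linarith
      calc (1 + t) ^ n * tailMass κ (t / 2 - 1)
          ≤ 4 ^ n * (1 + (1 + (t / 2 - 1)) ^ n) * tailMass κ (t / 2 - 1) := by gcongr
        _ = 4 ^ n * (tailMass κ (t / 2 - 1)
            + (1 + (t / 2 - 1)) ^ n * tailMass κ (t / 2 - 1)) := by ring
        _ ≤ _ := by gcongr
    calc _ ≤ (1 + t) ^ n * (tailMass κ (t / 2 - 1) * 2) := by gcongr
      _ = (1 + t) ^ n * tailMass κ (t / 2 - 1) * 2 := by ring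
      _ ≤ _ := by gcongr

/-! ### Operations on functions of exponential type -/

theorem IsEntireOfExpType.add {d : ℕ} {R : ℝ} {F G : EuclideanSpace ℂ (Fin d) → ℂ}
    (hF : IsEntireOfExpType R F) (hG : IsEntireOfExpType R G) :
    IsEntireOfExpType R fun z => F z + G z := by
  refine ⟨hF.1.add hG.1, fun ε hε => ?_⟩
  obtain ⟨C, hC⟩ := hF.2 ε hε
  obtain ⟨D, hD⟩ := hG.2 ε hε
  refine ⟨C + D, fun z => (norm_add_le _ _).trans ?_⟩
  rw [add_mul]
  exact add_le_add (hC z) (hD z)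

theorem IsEntireOfExpType.const_mul {d : ℕ} {R : ℝ} {F : EuclideanSpace ℂ (Fin d) → ℂ}
    (hF : IsEntireOfExpType R F) (c : ℂ) : IsEntireOfExpType R fun z => c * F z := by
  refine ⟨hF.1.const_mul c, fun ε hε => ?_⟩
  obtain ⟨C, hC⟩ := hF.2 ε hε
  refine ⟨‖c‖ * C, fun z => ?_⟩
  rw [norm_mul, mul_assoc]
  exact mul_le_mul_of_nonneg_left (hC z) (norm_nonneg c)

theorem isEntireOfExpType_const {d : ℕ} {R : ℝ} (hR : 0 < R) (c : ℂ) :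
    IsEntireOfExpType (d := d) R fun _ => c := by
  refine ⟨differentiable_const c, fun ε hε => ⟨‖c‖, fun z => ?_⟩⟩
  exact le_mul_of_one_le_right (norm_nonneg c) (Real.one_le_exp (by positivity))

theorem IsEntireOfExpType.comp_smul {d : ℕ} {F : EuclideanSpace ℂ (Fin d) → ℂ}
    (hF : IsEntireOfExpType 1 F) {R : ℝ} (hR : 0 < R) :
    IsEntireOfExpType R fun z => F ((R : ℂ) • z) := by
  refine ⟨hF.1.comp (differentiable_id.const_smul (R : ℂ)), fun ε hε => ?_⟩
  obtain ⟨C, hC⟩ := hF.2 (ε / R) (by positivity)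
  refine ⟨C, fun z => (hC _).trans (le_of_eq ?_)⟩
  rw [norm_smul, Complex.norm_real, Real.norm_of_nonneg hR.le, ← mul_assoc, add_mul, one_mul,
    div_mul_cancel₀ _ hR.ne']

/-! ### One-sided approximation at unit scale -/

/-- One-sided approximation at unit scale: `f` is constant on the balls `B(x, δ x)`. -/
theorem IsEntireKernel.exists_one_sided {d : ℕ} {K : EuclideanSpace ℂ (Fin d) → ℂ}
    {κ : EuclideanSpace ℝ (Fin d) → ℝ} (hK : IsEntireKernel K κ)
    {f δ : EuclideanSpace ℝ (Fin d) → ℝ} (hf : AEStronglyMeasurable f)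
    (hf0 : ∀ y, 0 ≤ f y) (hf1 : ∀ y, f y ≤ 1) (hδ : LipschitzWith 1 δ)
    (hfδ : ∀ x y, dist y x < δ x → f y = f x) :
    ∃ A B : EuclideanSpace ℂ (Fin d) → ℂ, IsEntireOfExpType 1 A ∧ IsEntireOfExpType 1 B ∧
      ∀ x, (A (realPoint x)).im = 0 ∧ (B (realPoint x)).im = 0 ∧
        (A (realPoint x)).re ≤ f x ∧ f x ≤ (B (realPoint x)).re ∧
        ‖B (realPoint x) - A (realPoint x)‖ ≤ 2 / (∫ y in Metric.closedBall 0 1, κ y) *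
          (tailMass κ (δ x / 2 - 1) + tailMass κ (δ x / 2)) := by
  have hi := hK.integrable
  have h0 := hK.nonneg
  set q : ℝ := ∫ y in Metric.closedBall 0 1, κ y with hqdef
  set I : ℝ := ∫ y, κ y with hIdef
  -- `κ` is continuous and positive at 0, so it has mass in the unit ball.
  have hq : 0 < q := by
    rw [hqdef, setIntegral_pos_iff_support_of_nonneg_ae
      (Filter.Eventually.of_forall h0) hi.integrableOn]
    refine lt_of_lt_of_le (IsOpen.measure_pos volume
      (U := Function.support κ ∩ Metric.ball 0 1) ?_ ?_) (measure_mono ?_)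
    · exact (hK.continuous.isOpen_support).inter Metric.isOpen_ball
    · exact ⟨0, hK.pos.ne', Metric.mem_ball_self one_pos⟩
    · exact Set.inter_subset_inter_right _ Metric.ball_subset_closedBall
  have hI : 0 < I :=
    hq.trans_le (setIntegral_le_integral hi (Filter.Eventually.of_forall h0))
  let m : EuclideanSpace ℂ (Fin d) → ℂ := convKernel K f
  let G : EuclideanSpace ℂ (Fin d) → ℂ := convKernel K fun y => tailMass κ (δ y - 1)
  have hm : IsEntireOfExpType 1 m := hK.isEntireOfExpType_convKernel hf (M := 1)
    fun y => abs_le.2 ⟨by linarith [hf0 y], hf1 y⟩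
  have hG : IsEntireOfExpType 1 G := hK.isEntireOfExpType_convKernel
    (aestronglyMeasurable_tailMass_comp hi h0 hδ) fun y => abs_tailMass_le hi h0 _
  -- These are `(m ∓ G/q)/I`: the error of `m` is at most `T(δ)`, and `G/q ≥ T(δ)` on `ℝ^d`.
  refine ⟨fun z => ((1 / I : ℝ) : ℂ) * m z + ((-(1 / (I * q)) : ℝ) : ℂ) * G z,
    fun z => ((1 / I : ℝ) : ℂ) * m z + ((1 / (I * q) : ℝ) : ℂ) * G z,
    (hm.const_mul _).add (hG.const_mul _), (hm.const_mul _).add (hG.const_mul _), fun x => ?_⟩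
  have h1 := abs_le.1 (abs_integral_mul_sub_le_tailMass hi h0 hf hf0 hf1 (hfδ x))
  have h2 := le_integral_tailMass_mul hi h0 hδ x
  have h3 := integral_tailMass_mul_le hi h0 hδ x
  have hmx : m (realPoint x) = _ := hK.convKernel_realPoint f x
  have hGx : G (realPoint x) = _ := hK.convKernel_realPoint (fun y => tailMass κ (δ y - 1)) x
  simp only [hmx, hGx]
  set a : ℝ := ∫ y, f y * κ (x - y)
  set g : ℝ := ∫ y, tailMass κ (δ y - 1) * κ (x - y)
  have hg : 0 ≤ g := (mul_nonneg hq.le (tailMass_nonneg h0 _)).trans h2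
  have h4 : tailMass κ (δ x) ≤ g / q := by rw [le_div_iff₀ hq, mul_comm]; exact h2
  simp only [← Complex.ofReal_mul, ← Complex.ofReal_add, ← Complex.ofReal_sub, Complex.ofReal_im,
    Complex.ofReal_re, Complex.norm_real, true_and]
  refine ⟨?_, ?_, ?_⟩
  · have h5 : 1 / I * a + -(1 / (I * q)) * g = (a - g / q) / I := by field_simp; ring
    rw [h5, div_le_iff₀ hI]
    linarith
  · have h5 : 1 / I * a + 1 / (I * q) * g = (a + g / q) / I := by field_simp
    rw [h5, le_div_iff₀ hI]
    linarith
  · have h5 : 1 / I * a + 1 / (I * q) * g - (1 / I * a + -(1 / (I * q)) * g)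
        = 2 / q * (g / I) := by field_simp; ring
    rw [h5, Real.norm_of_nonneg (by positivity)]
    have h6 : g / I ≤ tailMass κ (δ x / 2 - 1) + tailMass κ (δ x / 2) := by
      rw [div_le_iff₀ hI, mul_comm]; exact h3
    gcongr

/-! ### Distance to the boundary and dilation -/

/-- The ball misses the frontier, so it is covered by the disjoint open sets `interior s` and
`interior sᶜ`; being connected, it lies in one of them. -/
theorem mem_iff_of_dist_lt_infDist_frontier {E : Type*} [NormedAddCommGroup E] [NormedSpace ℝ E]
    {s : Set E} {x y : E} (h : dist y x < Metric.infDist x (frontier s)) : y ∈ s ↔ x ∈ s := by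
  have hx : x ∈ Metric.ball x (Metric.infDist x (frontier s)) :=
    Metric.mem_ball_self (dist_nonneg.trans_lt h)
  have hpre : IsPreconnected (Metric.ball x (Metric.infDist x (frontier s))) :=
    (convex_ball _ _).isPreconnected
  have hcov : Metric.ball x (Metric.infDist x (frontier s)) ⊆ interior s ∪ interior sᶜ := by
    intro w hw
    by_contra hcon
    rw [Set.mem_union, not_or, interior_compl, Set.notMem_compl_iff] at hcon
    have h1 := Metric.infDist_le_dist_of_mem (x := x) (s := frontier s) ⟨hcon.2, hcon.1⟩
    rw [Metric.mem_ball, dist_comm] at hw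
    exact absurd hw (not_lt.2 h1)
  have hdisj : Disjoint (interior s) (interior sᶜ) :=
    disjoint_compl_right.mono interior_subset interior_subset
  rcases hcov hx with hxs | hxs
  · have := hpre.subset_left_of_subset_union isOpen_interior isOpen_interior hdisj hcov ⟨x, hx, hxs⟩
    exact iff_of_true (interior_subset (this h)) (interior_subset hxs)
  · have := hpre.subset_right_of_subset_union isOpen_interior isOpen_interior hdisj hcov
      ⟨x, hx, hxs⟩
    exact iff_of_false (interior_subset (this h)) (interior_subset hxs)

theorem lipschitzWith_mul_infDist_inv_smul {E : Type*} [NormedAddCommGroup E] [NormedSpace ℝ E]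
    (s : Set E) {R : ℝ} (hR : 0 < R) :
    LipschitzWith 1 fun y : E => R * Metric.infDist (R⁻¹ • y) s := by
  refine LipschitzWith.of_le_add fun x y => ?_
  have h := Metric.infDist_le_infDist_add_dist (s := s) (x := R⁻¹ • x) (y := R⁻¹ • y)
  rw [dist_smul₀, Real.norm_of_nonneg (inv_nonneg.2 hR.le)] at h
  calc R * Metric.infDist (R⁻¹ • x) s
      ≤ R * (Metric.infDist (R⁻¹ • y) s + R⁻¹ * dist x y) := by gcongr
    _ = _ := by field_simp

theorem exists_pow_mul_exp_neg_le (n : ℕ) :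
    ∃ C : ℝ, 0 ≤ C ∧ ∀ t : ℝ, 0 ≤ t → (1 + t) ^ n * Real.exp (-t) ≤ C := by
  obtain ⟨C, hC0, hC⟩ := one_add_pow_le_exp one_pos n
  refine ⟨C, hC0, fun t ht => ?_⟩
  have h := hC t ht
  rwa [one_mul, ← div_le_iff₀ (Real.exp_pos t), div_eq_mul_inv, ← Real.exp_neg] at h

theorem frontier_eq_empty_of_subsingleton {X : Type*} [TopologicalSpace X] [Subsingleton X]
    (s : Set X) : frontier s = ∅ :=
  (isClopen_discrete s).frontier_eq

theorem exists_exact_of_frontier_eq_empty {d : ℕ} {Ω : Set (EuclideanSpace ℝ (Fin d))}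
    (h : frontier Ω = ∅) {R : ℝ} (hR : 0 < R) :
    ∃ A : EuclideanSpace ℂ (Fin d) → ℂ, IsEntireOfExpType R A ∧
      ∀ x, A (realPoint x) = (Ω.indicator (fun _ => (1 : ℝ)) x : ℝ) := by
  rcases frontier_eq_empty_iff.1 h with rfl | rfl
  · exact ⟨fun _ => 0, isEntireOfExpType_const hR 0, fun x => by simp⟩
  · exact ⟨fun _ => 1, isEntireOfExpType_const hR 1, fun x => by simp⟩

/-! ### The main theorem -/

theorem theorem1 (d : ℕ) :
    ∃ ψ : ℝ → ℝ,
      (∀ t : ℝ, 0 ≤ t → 0 < ψ t) ∧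
      (∀ α : ℝ, ∃ c : ℝ, ∀ t : ℝ, 0 ≤ t → ψ t ≤ c * (1 + t) ^ (-α)) ∧
      ∀ Ω : Set (EuclideanSpace ℝ (Fin d)),
        MeasureTheory.NullMeasurableSet Ω MeasureTheory.volume →
        ∀ R : ℝ, 0 < R →
          ∃ A B : EuclideanSpace ℂ (Fin d) → ℂ,
            IsEntireOfExpType R A ∧ IsEntireOfExpType R B ∧
            ∀ x : EuclideanSpace ℝ (Fin d),
              (A (realPoint x)).im = 0 ∧ (B (realPoint x)).im = 0 ∧
              (A (realPoint x)).re ≤ Ω.indicator (fun _ => (1 : ℝ)) x ∧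
              Ω.indicator (fun _ => (1 : ℝ)) x ≤ (B (realPoint x)).re ∧
              -- the distance to a non-empty boundary is a real number
              ((frontier Ω).Nonempty →
                ‖B (realPoint x) - A (realPoint x)‖ ≤ ψ (R * Metric.infDist x (frontier Ω))) ∧
              -- the distance to an empty boundary is infinite, where `ψ` vanishes
              (frontier Ω = ∅ → B (realPoint x) = A (realPoint x)) := by
  rcases eq_or_ne d 0 with rfl | hd
  -- In dimension 0 every frontier is empty, so any positive rapidly decreasing `ψ` serves.
  · refine ⟨fun t => Real.exp (-t), fun t _ => Real.exp_pos _, ?_, fun Ω _ R hR => ?_⟩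
    · exact exists_rpow_bound_of_pow_bound fun n => exists_pow_mul_exp_neg_le n
    · have h := frontier_eq_empty_of_subsingleton Ω
      obtain ⟨A, hA, hAx⟩ := exists_exact_of_frontier_eq_empty h hR
      refine ⟨A, A, hA, hA, fun x => ?_⟩
      simp [hAx x]
  · obtain ⟨K, κ, hK⟩ := exists_isEntireKernel d hd
    have h0 := hK.nonneg
    set c : ℝ := 2 / ∫ y in Metric.closedBall 0 1, κ y with hc
    have hc0 : 0 ≤ c := div_nonneg zero_le_two (integral_nonneg fun y => h0 y)
    have hpos : ∀ t, 0 ≤ c * (tailMass κ (t / 2 - 1) + tailMass κ (t / 2)) := fun t =>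
      mul_nonneg hc0 (add_nonneg (tailMass_nonneg h0 _) (tailMass_nonneg h0 _))
    -- The summand `exp (-t)` makes `ψ` strictly positive without a lower bound on the tail mass.
    refine ⟨fun t => c * (tailMass κ (t / 2 - 1) + tailMass κ (t / 2)) + Real.exp (-t),
      fun t _ => add_pos_of_nonneg_of_pos (hpos t) (Real.exp_pos _), ?_, fun Ω hΩ R hR => ?_⟩
    · refine exists_rpow_bound_of_pow_bound fun n => ?_
      obtain ⟨C, hC0, hC⟩ := exists_pow_mul_tailMass_half_le h0 hK.integrable_moment n
      obtain ⟨D, hD0, hD⟩ := exists_pow_mul_exp_neg_le n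
      refine ⟨c * C + D, by positivity, fun t ht => ?_⟩
      have h1 := mul_le_mul_of_nonneg_left (hC t ht) hc0
      have h2 := hD t ht
      linarith
    · rcases Set.eq_empty_or_nonempty (frontier Ω) with h | h
      · obtain ⟨A, hA, hAx⟩ := exists_exact_of_frontier_eq_empty h hR
        refine ⟨A, A, hA, hA, fun x => ?_⟩
        simp [hAx x, h]
      · have hR' : R ≠ 0 := hR.ne'
        -- The dilated problem has `f y = χ_Ω(y/R)` and `δ y = R dist(y/R, ∂Ω)`. Null measurability
        -- survives since dilations preserve null sets.
        have hfm : AEStronglyMeasurable fun y =>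
            Ω.indicator (fun _ => (1 : ℝ)) (R⁻¹ • y) :=
          ((aestronglyMeasurable_const (b := (1 : ℝ))).indicator₀ hΩ).comp_quasiMeasurePreserving
            (Measure.quasiMeasurePreserving_smul volume (inv_ne_zero hR'))
        obtain ⟨A, B, hA, hB, hAB⟩ := hK.exists_one_sided hfm
          (fun y => Set.indicator_nonneg (fun _ _ => zero_le_one) _)
          (fun y => Set.indicator_le_self' (fun _ _ => zero_le_one) _)
          (lipschitzWith_mul_infDist_inv_smul (frontier Ω) hR)
          (fun x y hxy => by
            have h1 : dist (R⁻¹ • y) (R⁻¹ • x) < Metric.infDist (R⁻¹ • x) (frontier Ω) := by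
              rw [dist_smul₀, Real.norm_of_nonneg (inv_nonneg.2 hR.le)]
              rwa [inv_mul_lt_iff₀ hR]
            have h2 := mem_iff_of_dist_lt_infDist_frontier h1
            by_cases hx : R⁻¹ • x ∈ Ω
            · rw [Set.indicator_of_mem hx, Set.indicator_of_mem (h2.2 hx)]
            · rw [Set.indicator_of_notMem hx, Set.indicator_of_notMem (mt h2.1 hx)])
        refine ⟨_, _, hA.comp_smul hR, hB.comp_smul hR, fun x => ?_⟩
        obtain ⟨h1, h2, h3, h4, h5⟩ := hAB (R • x)
        rw [inv_smul_smul₀ hR'] at h3 h4 h5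
        rw [← realPoint_smul]
        refine ⟨h1, h2, h3, h4, fun _ => h5.trans ?_, fun h6 => absurd h6 h.ne_empty⟩
        exact le_add_of_nonneg_right (Real.exp_pos _).le
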